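/- Conventions. Let $d\ge 1$. A state on $\mathbb C^d$ is a positive semidefinite $d\times d$ matrix of trace one. An ensemble $S=\{q_x,\rho_x\}_{x=1}^n$ consists of states $\rho_x$ on $\mathbb C^d$ and probabilities $q_x\ge 0$ with $\sum_x q_x=1$; for $d=2$ it is a qubit ensemble. A POVM is a family $M=\{M_x\}_{x=1}^n$ of positive semidefinite matrices with $\sum_x M_x=\mathbb I$; it identifies the indices in $\mathcal I=\{x: M_x\ne 0\}$. The guessing probability of $S$ is $P_g=\max_M\sum_x q_x\,\mathrm{tr}[M_x\rho_x]$, the maximum being over all POVMs, and a POVM is optimal for $S$ if it attains this maximum. States $\sigma_x$ and numbers $r_x\ge 0$ are complementary states of $S$ and their parameters if there are a matrix $K$ and a POVM $M'$ such that $K=q_x\rho_x+r_x\sigma_x$ and $r_x\,\mathrm{tr}[M'_x\sigma_x]=0$ for all $x$. A channel $\mathcal N$ is a completely positive, trace preserving linear map on the $d\times d$ matrices. Let $P_g^{(\mathcal N)}$ be the guessing probability of $S^{(\mathcal N)}=\{q_x,\mathcal N[\rho_x]\}_{x=1}^n$ and $\delta_{\mathcal N}=P_g-P_g^{(\mathcal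 N)}$. The channel $\mathcal N$ preserves an optimal measurement $M$ of $S$ if $M$ is optimal for $S^{(\mathcal N)}$ as well. Theorem. Let $S=\{q_x,\rho_x\}_{x=1}^n$ be an ensemble on $\mathbb C^d$ with complementary states $\sigma_x$ and parameters $r_x$, let $M$ be an optimal measurement for $S$, identifying the indices in $\mathcal I$, and let $\mathcal N$ be a channel. Consider the condition $$(\ast)\qquad q_x\mathcal N[\rho_x]-q_y\mathcal N[\rho_y]=q_x\rho_x-q_y\rho_y+\delta_{\mathcal N}(\sigma_x-\sigma_y)\quad\text{and}\quad r_x\ge\delta_{\mathcal N}\ge 0\qquad\text{for all }x,y\in\mathcal I .$$ 1. If $d=2$, then $\mathcal N$ preserves $M$ if and only if $(\ast)$ holds. 2. For every $d$, if $(\ast)$ holds, then $\mathcal N$ preserves $M$. 3. For every $d\ge 3$ the condition is not necessary: there are $S,\sigma_x,r_x,M,\mathcal N$ as above such that $\mathcal N$ preserves $M$ but $(\ast)$ fails. -/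

import Mathlib

namespace QDisc

open scoped MatrixOrder ComplexOrder Matrix.Norms.L2Operator CStarAlgebra

/-- Operators on the `d`-dimensional Hilbert space `ℂ^d`. -/
abbrev Op (d : ℕ) : Type := Matrix (Fin d) (Fin d) ℂ

/-- A quantum state (density matrix): a positive semidefinite (in particular Hermitian) operator
of trace one. -/
structure IsState {d : ℕ} (ρ : Op d) : Prop where
  posSemidef : ρ.PosSemidef
  trace_eq_one : ρ.trace = 1

/-- An ensemble `{q_x, ρ_x}` of `n` states in dimension `d`. -/
structure Ensemble (d n : ℕ) where
  /-- The a priori probabilities `q_x`. -/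
  prob : Fin n → ℝ
  /-- The states `ρ_x`. -/
  state : Fin n → Op d
  prob_nonneg : ∀ x, 0 ≤ prob x
  sum_prob : ∑ x, prob x = 1
  isState : ∀ x, IsState (state x)

/-- A quantum channel: a completely positive, trace preserving linear map. -/
structure Channel (d : ℕ) where
  /-- The underlying completely positive map. -/
  toCP : Op d →CP Op d
  trace_map : ∀ A : Op d, (toCP A).trace = A.trace

noncomputable instance (d : ℕ) : CoeFun (Channel d) (fun _ => Op d → Op d) := ⟨fun N A => N.toCP A⟩

theorem Channel.isState_map {d : ℕ} (N : Channel d) {ρ : Op d} (h : IsState ρ) :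
    IsState (N ρ) where
  posSemidef := by
    have h0 := h.posSemidef
    rw [← Matrix.nonneg_iff_posSemidef] at h0 ⊢
    exact map_nonneg N.toCP h0
  trace_eq_one := by rw [N.trace_map, h.trace_eq_one]

/-- The ensemble `{q_x, N[ρ_x]}` after the use of the channel `N`. -/
noncomputable def Ensemble.map {d n : ℕ} (S : Ensemble d n) (N : Channel d) : Ensemble d n where
  prob := S.prob
  state := fun x => N (S.state x)
  prob_nonneg := S.prob_nonneg
  sum_prob := S.sum_prob
  isState := fun x => N.isState_map (S.isState x)

/-- A measurement (POVM) with `n` outcomes. -/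
structure IsPOVM {d n : ℕ} (M : Fin n → Op d) : Prop where
  posSemidef : ∀ x, (M x).PosSemidef
  sum_eq_one : ∑ x, M x = 1

/-- The probability `∑ₓ q_x tr[M_x ρ_x]` of guessing correctly with the measurement `M`. -/
noncomputable def Ensemble.success {d n : ℕ} (S : Ensemble d n) (M : Fin n → Op d) : ℝ :=
  ∑ x, S.prob x * (M x * S.state x).trace.re

/-- The guessing probability `P_g`: the maximum of the success probability over all POVMs. -/
noncomputable def Ensemble.guessingProb {d n : ℕ} (S : Ensemble d n) : ℝ :=
  sSup {p : ℝ | ∃ M : Fin n → Op d, IsPOVM M ∧ p = S.success M}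

/-- `M` solves the minimum error discrimination problem for the ensemble `S`. -/
structure Ensemble.IsOptimal {d n : ℕ} (S : Ensemble d n) (M : Fin n → Op d) : Prop where
  isPOVM : IsPOVM M
  success_le : ∀ M' : Fin n → Op d, IsPOVM M' → S.success M' ≤ S.success M

/-- The index set of the states identified by the measurement `M`. -/
def identified {d n : ℕ} (M : Fin n → Op d) : Set (Fin n) := {x | M x ≠ 0}

/-- `σ_x` are complementary states of `S`, with parameters `r_x`: the Karush-Kuhn-Tucker conditions
`K = q_x ρ_x + r_x σ_x` and `r_x tr[M_x σ_x] = 0` hold for some symmetry operator `K` and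
some POVM `M`. -/
structure Ensemble.IsComplementary {d n : ℕ} (S : Ensemble d n) (σ : Fin n → Op d)
    (r : Fin n → ℝ) : Prop where
  isState : ∀ x, IsState (σ x)
  nonneg : ∀ x, 0 ≤ r x
  kkt : ∃ (K : Op d) (M : Fin n → Op d), IsPOVM M ∧
    (∀ x, K = S.prob x • S.state x + r x • σ x) ∧
    (∀ x, (r x : ℂ) * (M x * σ x).trace = 0)

/-- The guessing degradation `δ_N = P_g - P_g^{(N)}`. -/
noncomputable def Ensemble.degradation {d n : ℕ} (S : Ensemble d n) (N : Channel d) : ℝ :=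
  S.guessingProb - (S.map N).guessingProb

/-- The channel `N` preserves the optimal measurement `M` of `S`: the POVM `M` solves the
discrimination problem before and after the use of the channel. -/
def Ensemble.Preserves {d n : ℕ} (S : Ensemble d n) (N : Channel d) (M : Fin n → Op d) : Prop :=
  S.IsOptimal M ∧ (S.map N).IsOptimal M

/-- The conditions `q_x N[ρ_x] - q_y N[ρ_y] = q_x ρ_x - q_y ρ_y + δ_N (σ_x - σ_y)` and
`r_x ≥ δ_N ≥ 0` for all indices `x`, `y` identified by `M`. -/
def Ensemble.OMPCondition {d n : ℕ} (S : Ensemble d n) (N : Channel d) (M : Fin n → Op d)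
    (σ : Fin n → Op d) (r : Fin n → ℝ) : Prop :=
  ∀ x ∈ identified M, ∀ y ∈ identified M,
    S.prob x • N (S.state x) - S.prob y • N (S.state y) =
      S.prob x • S.state x - S.prob y • S.state y + S.degradation N • (σ x - σ y) ∧
    S.degradation N ≤ r x ∧ 0 ≤ S.degradation N

end QDisc

/-! Discrimination is a semidefinite program whose dual minimises `tr K` over all `K ≥ q_x ρ_x`.
Complementary states encode the slack `K - q_x ρ_x = r_x σ_x` of a dual optimum, which every optimal
`M x` annihilates (`exists_dual`). If `M` stays optimal after `N`, then `K' = symmetryOp M` of the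
image ensemble is dual optimal there (`posSemidef_symmetryOp_sub`), of trace `tr K - δ`. On a qubit
a nonzero `M x` has kernel of dimension at most one, so both slacks at `x` are proportional;
comparing traces gives `K' - q_x N[ρ_x] = (r_x - δ) σ_x`, and differences over `x`, `y` yield the
condition. Conversely, the condition makes `q_x N[ρ_x] + (r_x - δ) σ_x` independent of `x` in the
identified set, and `M` attains its trace, which is the new guessing probability. For `d ≥ 3` a
kernel can be larger, leaving room to move a state without harming `M`. -/

namespace QDisc

open scoped MatrixOrder ComplexOrder Matrix.Norms.L2Operator CStarAlgebra

/-! ### Traces and products of positive semidefinite matrices -/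

section PosSemidef

variable {d : ℕ} {A B : Op d}

theorem exists_eq_conjTranspose_mul_self (hA : A.PosSemidef) :
    ∃ C : Op d, A = C.conjTranspose * C := by
  rw [← Matrix.nonneg_iff_posSemidef] at hA
  obtain ⟨C, hC⟩ := CStarAlgebra.nonneg_iff_eq_star_mul_self.mp hA
  exact ⟨C, hC⟩

theorem trace_mul_nonneg (hA : A.PosSemidef) (hB : B.PosSemidef) : 0 ≤ (A * B).trace := by
  obtain ⟨C, rfl⟩ := exists_eq_conjTranspose_mul_self hA
  rw [Matrix.mul_assoc, Matrix.trace_mul_comm]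
  exact (hB.mul_mul_conjTranspose_same C).trace_nonneg

theorem trace_mul_re_nonneg (hA : A.PosSemidef) (hB : B.PosSemidef) : 0 ≤ (A * B).trace.re :=
  (Complex.nonneg_iff.mp (trace_mul_nonneg hA hB)).1

theorem trace_mul_eq_zero_of_re (hA : A.PosSemidef) (hB : B.PosSemidef)
    (h : (A * B).trace.re = 0) : (A * B).trace = 0 :=
  Complex.ext h (Complex.nonneg_iff.mp (trace_mul_nonneg hA hB)).2.symm

/-- With `A = C* C` and `B = D* D`, the trace is the squared Hilbert-Schmidt norm of `D C*`. -/
theorem mul_eq_zero_of_trace_mul_eq_zero (hA : A.PosSemidef) (hB : B.PosSemidef)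
    (h : (A * B).trace = 0) : A * B = 0 := by
  obtain ⟨C, rfl⟩ := exists_eq_conjTranspose_mul_self hA
  obtain ⟨D, rfl⟩ := exists_eq_conjTranspose_mul_self hB
  have h1 : D * C.conjTranspose = 0 := by
    rw [← Matrix.trace_conjTranspose_mul_self_eq_zero_iff, ← h, Matrix.conjTranspose_mul,
      Matrix.conjTranspose_conjTranspose, Matrix.mul_assoc C.conjTranspose,
      Matrix.trace_mul_comm C.conjTranspose]
    simp only [Matrix.mul_assoc]
  have h2 : C * D.conjTranspose = 0 := by
    have := congrArg Matrix.conjTranspose h1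
    simpa using this
  calc C.conjTranspose * C * (D.conjTranspose * D)
      = C.conjTranspose * (C * D.conjTranspose) * D := by simp only [Matrix.mul_assoc]
    _ = 0 := by simp [h2]

theorem trace_re_smul (r : ℝ) (A : Op d) : (r • A).trace.re = r * A.trace.re := by
  simp [Matrix.trace_smul]

theorem trace_eq_ofReal_re (hA : A.PosSemidef) : A.trace = (A.trace.re : ℂ) :=
  Complex.ext rfl (Complex.nonneg_iff.mp hA.trace_nonneg).2.symm

theorem posSemidef_real_smul {r : ℝ} (hr : 0 ≤ r) (hA : A.PosSemidef) : (r • A).PosSemidef := by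
  have := hA.smul (a := (r : ℂ)) (by exact_mod_cast hr)
  rwa [Complex.coe_smul] at this

end PosSemidef

/-! ### Rank-one rigidity in dimension two -/

/-- Proportional rows plus hermiticity determine the matrix up to a scalar from the ratio `t` alone,
so two matrices sharing `t` are proportional. -/
theorem _root_.Matrix.IsHermitian.fin_two_eq_smul {A : Op 2} (hA : A.IsHermitian) {t : ℂ}
    (h0 : A 1 0 = t * A 0 0) (h1 : A 1 1 = t * A 0 1) :
    A = A 0 0 • !![1, star t; t, t * star t] := by
  have h2 : A 0 1 = star t * A 0 0 := by
    rw [← hA.apply 0 1, h0, star_mul', hA.apply 0 0]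
  ext i j
  fin_cases i <;> fin_cases j <;> simp [h0, h1, h2] <;> ring

theorem _root_.Matrix.IsHermitian.fin_two_eq_smul' {A : Op 2} (hA : A.IsHermitian) {t : ℂ}
    (h0 : A 0 0 = t * A 1 0) (h1 : A 0 1 = t * A 1 1) :
    A = A 1 1 • !![t * star t, t; star t, 1] := by
  have h2 : A 1 0 = star t * A 1 1 := by
    rw [← hA.apply 1 0, h1, star_mul', hA.apply 1 1]
  ext i j
  fin_cases i <;> fin_cases j <;> simp [h0, h1, h2] <;> ring

/-- Two Hermitian qubit operators annihilated by the same nonzero operator are proportional. -/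
theorem trace_smul_eq_of_mul_eq_zero {M A B : Op 2} (hM : M ≠ 0) (hA : A.IsHermitian)
    (hB : B.IsHermitian) (hMA : M * A = 0) (hMB : M * B = 0) :
    B.trace • A = A.trace • B := by
  have smul_comm_of : ∀ {a b : ℂ} {T : Op 2}, A = a • T → B = b • T →
      B.trace • A = A.trace • B := by
    rintro a b T rfl rfl
    rw [Matrix.trace_smul, Matrix.trace_smul, smul_smul, smul_smul, smul_eq_mul, smul_eq_mul]
    ring_nf
  -- A single nonzero row of `M` already forces the same ratio between the rows of `A` and of `B`.
  obtain ⟨i, j, hij⟩ : ∃ i j, M i j ≠ 0 := by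
    by_contra! h
    exact hM (Matrix.ext h)
  have eA : ∀ k, M i 0 * A 0 k + M i 1 * A 1 k = 0 := fun k => by
    simpa [Matrix.mul_apply, Fin.sum_univ_two] using congrFun (congrFun hMA i) k
  have eB : ∀ k, M i 0 * B 0 k + M i 1 * B 1 k = 0 := fun k => by
    simpa [Matrix.mul_apply, Fin.sum_univ_two] using congrFun (congrFun hMB i) k
  have solve : ∀ {m m' a a' : ℂ}, m' ≠ 0 → m * a + m' * a' = 0 → a' = -m / m' * a := by
    intro m m' a a' hm h
    field_simp
    linear_combination h
  rcases (Fin.exists_fin_two (p := fun j => M i j ≠ 0)).mp ⟨j, hij⟩ with h | h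
  · have solve' : ∀ {a a' : ℂ}, M i 0 * a + M i 1 * a' = 0 → a = -M i 1 / M i 0 * a' :=
      fun e => solve h (by rw [add_comm]; exact e)
    exact smul_comm_of (hA.fin_two_eq_smul' (solve' (eA 0)) (solve' (eA 1)))
      (hB.fin_two_eq_smul' (solve' (eB 0)) (solve' (eB 1)))
  · exact smul_comm_of (hA.fin_two_eq_smul (solve h (eA 0)) (solve h (eA 1)))
      (hB.fin_two_eq_smul (solve h (eB 0)) (solve h (eB 1)))

/-! ### Semidefinite duality for the guessing probability -/

section Duality

variable {d n : ℕ} (S : Ensemble d n)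

/-- Exact duality gap, for an arbitrary `K`: since the `M x` sum to one, `tr K` splits as the sum of
`tr (M x * K)`. -/
theorem Ensemble.success_eq {K : Op d} {M : Fin n → Op d} (hM : IsPOVM M) :
    S.success M = K.trace.re - ∑ x, (M x * (K - S.prob x • S.state x)).trace.re := by
  have h1 : K.trace.re = ∑ x, (M x * K).trace.re := by
    rw [← Complex.re_sum, ← Matrix.trace_sum, ← Finset.sum_mul, hM.sum_eq_one, one_mul]
  rw [h1, ← Finset.sum_sub_distrib, Ensemble.success]
  refine Finset.sum_congr rfl fun x _ => ?_
  rw [mul_sub, Matrix.trace_sub, Complex.sub_re, Matrix.mul_smul, trace_re_smul]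
  ring

theorem Ensemble.success_le_trace {K : Op d} {M : Fin n → Op d} (hM : IsPOVM M)
    (hK : ∀ x, (K - S.prob x • S.state x).PosSemidef) : S.success M ≤ K.trace.re := by
  rw [S.success_eq (K := K) hM]
  have := Finset.sum_nonneg fun x (_ : x ∈ Finset.univ) =>
    trace_mul_re_nonneg (hM.posSemidef x) (hK x)
  linarith

theorem Ensemble.success_le_one {M : Fin n → Op d} (hM : IsPOVM M) : S.success M ≤ 1 := by
  have h : (∑ y, S.prob y • S.state y).trace.re = 1 := by
    rw [Matrix.trace_sum, Complex.re_sum, ← S.sum_prob]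
    refine Finset.sum_congr rfl fun x _ => ?_
    rw [trace_re_smul, (S.isState x).trace_eq_one]
    simp
  rw [← h]
  -- The average operator has trace one and dominates each of its summands, so it is dual feasible.
  refine S.success_le_trace hM fun x => ?_
  rw [← Finset.add_sum_erase _ _ (Finset.mem_univ x), add_sub_cancel_left]
  exact Matrix.posSemidef_sum _ fun y _ =>
    posSemidef_real_smul (S.prob_nonneg y) (S.isState y).posSemidef

variable {S}

theorem Ensemble.IsOptimal.guessingProb_eq {M : Fin n → Op d} (hM : S.IsOptimal M) :
    S.guessingProb = S.success M := by
  refine IsGreatest.csSup_eq ⟨⟨M, hM.isPOVM, rfl⟩, ?_⟩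
  rintro _ ⟨M', hM', rfl⟩
  exact hM.success_le M' hM'

theorem Ensemble.success_le_guessingProb {M : Fin n → Op d} (hM : IsPOVM M) :
    S.success M ≤ S.guessingProb := by
  refine le_csSup ⟨1, ?_⟩ ⟨M, hM, rfl⟩
  rintro _ ⟨M', hM', rfl⟩
  exact S.success_le_one hM'

/-! ### First-order optimality conditions -/

/-- The measurement obtained from `M` by moving the weight `1 - (1 - P)²` to the outcome `j`. -/
noncomputable def shiftPOVM (M : Fin n → Op d) (j : Fin n) (P : Op d) (x : Fin n) : Op d :=
  (1 - P) * M x * (1 - P) + if x = j then 2 • P - P * P else 0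

theorem isPOVM_shiftPOVM {M : Fin n → Op d} (hM : IsPOVM M) (j : Fin n) {P : Op d}
    (hP : P.IsHermitian) (hP2 : (2 • P - P * P).PosSemidef) : IsPOVM (shiftPOVM M j P) where
  posSemidef x := by
    have h1 : ((1 - P) * M x * (1 - P)).PosSemidef := by
      have := (hM.posSemidef x).mul_mul_conjTranspose_same (1 - P)
      rwa [Matrix.conjTranspose_sub, Matrix.conjTranspose_one, hP.eq] at this
    unfold shiftPOVM
    split_ifs
    · exact h1.add hP2
    · simpa using h1
  sum_eq_one := by
    simp only [shiftPOVM, Finset.sum_add_distrib, Finset.sum_ite_eq', Finset.mem_univ, if_true,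
      ← Finset.sum_mul, ← Finset.mul_sum, hM.sum_eq_one]
    noncomm_ring

theorem nonpos_of_forall_add_mul_nonpos {a b : ℝ}
    (h : ∀ ε : ℝ, 0 < ε → ε ≤ 1 → ε * a + ε ^ 2 * b ≤ 0) : a ≤ 0 := by
  by_contra! ha
  have hb : 0 < |b| + 1 := by positivity
  -- This size keeps `ε * |b|` at most `a / 2`, too small to cancel a positive `a`.
  set ε := min 1 (a / (2 * (|b| + 1))) with hε
  have h0 : 0 < ε := lt_min one_pos (by positivity)
  have h1 : ε * (2 * (|b| + 1)) ≤ a := by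
    rw [← le_div_iff₀ (by positivity)]
    exact min_le_right _ _
  have h2 := h ε h0 (min_le_left _ _)
  have h3 : ε * (a + ε * b) ≤ 0 := by linarith
  have h4 : a + ε * b ≤ 0 := nonpos_of_mul_nonpos_right h3 h0
  have h5 : ε * -|b| ≤ ε * b := mul_le_mul_of_nonneg_left (neg_abs_le b) h0.le
  nlinarith [mul_nonneg h0.le (abs_nonneg b)]

/-- The real part of the operator `∑ₓ q_x ρ_x M_x`. -/
noncomputable def Ensemble.symmetryOp (S : Ensemble d n) (M : Fin n → Op d) : Op d :=
  ∑ x, (S.prob x / 2) • (S.state x * M x + M x * S.state x)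

theorem Ensemble.symmetryOp_isHermitian {M : Fin n → Op d} (hM : IsPOVM M) :
    (S.symmetryOp M).IsHermitian := by
  rw [Matrix.IsHermitian, Ensemble.symmetryOp, Matrix.conjTranspose_sum]
  refine Finset.sum_congr rfl fun x _ => ?_
  rw [Matrix.conjTranspose_smul, Matrix.conjTranspose_add, Matrix.conjTranspose_mul,
    Matrix.conjTranspose_mul, (hM.posSemidef x).isHermitian.eq,
    (S.isState x).posSemidef.isHermitian.eq, add_comm]
  simp

theorem Ensemble.trace_symmetryOp (M : Fin n → Op d) :
    (S.symmetryOp M).trace.re = S.success M := by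
  rw [Ensemble.symmetryOp, Matrix.trace_sum, Complex.re_sum, Ensemble.success]
  refine Finset.sum_congr rfl fun x _ => ?_
  rw [trace_re_smul, Matrix.trace_add, Matrix.trace_mul_comm (S.state x), Complex.add_re]
  ring

/-- Expansion in `ε`: the cross terms `P * M x` and `M x * P` produce the symmetrised `symmetryOp`,
and the linear coefficient is the quantity whose sign optimality controls. -/
theorem Ensemble.success_shiftPOVM (M : Fin n → Op d) (j : Fin n) (P : Op d) (ε : ℝ) :
    S.success (shiftPOVM M j (ε • P)) = S.success M +
      (ε * (2 * (P * (S.prob j • S.state j - S.symmetryOp M)).trace.re) +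
      ε ^ 2 * (∑ x, S.prob x * (P * M x * P * S.state x).trace.re -
        S.prob j * (P * P * S.state j).trace.re)) := by
  have h1 : ∀ x, (shiftPOVM M j (ε • P) x * S.state x).trace.re =
      (M x * S.state x).trace.re
        - ε * (P * (S.state x * M x + M x * S.state x)).trace.re
        + ε ^ 2 * (P * M x * P * S.state x).trace.re
        + if x = j then 2 * ε * (P * S.state x).trace.re
            - ε ^ 2 * (P * P * S.state x).trace.re else 0 := by
    intro x
    have e1 : (M x * P * S.state x).trace = (P * (S.state x * M x)).trace := by
      rw [Matrix.mul_assoc, Matrix.trace_mul_comm, Matrix.mul_assoc]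
    have e2 : ((1 - ε • P) * M x * (1 - ε • P)) * S.state x =
        M x * S.state x - ε • (P * (M x * S.state x)) - ε • (M x * P * S.state x)
          + (ε ^ 2) • (P * M x * P * S.state x) := by
      simp only [sub_mul, mul_sub, one_mul, mul_one, Matrix.smul_mul, Matrix.mul_smul, smul_smul,
        Matrix.mul_assoc, pow_two]
      abel
    have e3 : (2 • (ε • P) - (ε • P) * (ε • P)) * S.state x =
        (2 * ε) • (P * S.state x) - (ε ^ 2) • (P * P * S.state x) := by
      simp only [sub_mul, Matrix.smul_mul, Matrix.mul_smul, smul_smul, pow_two, two_smul, add_mul,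
        two_mul, add_smul]
    rw [shiftPOVM, add_mul, Matrix.trace_add, Complex.add_re, e2]
    split_ifs
    · rw [e3]
      simp only [Matrix.trace_add, Matrix.trace_sub, Complex.add_re, Complex.sub_re, trace_re_smul,
        e1, mul_add]
      ring
    · simp only [Matrix.trace_add, Matrix.trace_sub, Complex.add_re, Complex.sub_re, trace_re_smul,
        e1, mul_add, zero_mul, Matrix.trace_zero, Complex.zero_re]
      ring
  have h2 : (P * S.symmetryOp M).trace.re =
      ∑ x, S.prob x / 2 * (P * (S.state x * M x + M x * S.state x)).trace.re := by
    rw [Ensemble.symmetryOp, Finset.mul_sum, Matrix.trace_sum, Complex.re_sum]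
    refine Finset.sum_congr rfl fun x _ => ?_
    rw [Matrix.mul_smul, trace_re_smul]
  have h3 : (P * (S.prob j • S.state j - S.symmetryOp M)).trace.re =
      S.prob j * (P * S.state j).trace.re -
      ∑ x, S.prob x / 2 * (P * (S.state x * M x + M x * S.state x)).trace.re := by
    rw [mul_sub, Matrix.trace_sub, Complex.sub_re, h2, Matrix.mul_smul, trace_re_smul]
  have h4 : ∀ x, S.prob x * (shiftPOVM M j (ε • P) x * S.state x).trace.re =
      S.prob x * (M x * S.state x).trace.re
        - 2 * ε * (S.prob x / 2 * (P * (S.state x * M x + M x * S.state x)).trace.re)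
        + ε ^ 2 * (S.prob x * (P * M x * P * S.state x).trace.re)
        + if x = j then S.prob x * (2 * ε * (P * S.state x).trace.re
            - ε ^ 2 * (P * P * S.state x).trace.re) else 0 := by
    intro x
    rw [h1]
    split_ifs <;> ring
  rw [h3, Ensemble.success, Ensemble.success, Finset.sum_congr rfl fun x _ => h4 x]
  simp only [Finset.sum_add_distrib, Finset.sum_sub_distrib, ← Finset.mul_sum, Finset.sum_ite_eq',
    Finset.mem_univ, if_true]
  ring

/-- **Necessity of the optimality conditions**: the real part of `∑ₓ q_x ρ_x M_x` dominates
every `q_x ρ_x` when `M` is optimal. -/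
theorem Ensemble.IsOptimal.posSemidef_symmetryOp_sub {M : Fin n → Op d} (hM : S.IsOptimal M)
    (j : Fin n) : (S.symmetryOp M - S.prob j • S.state j).PosSemidef := by
  have hherm : (S.symmetryOp M - S.prob j • S.state j).IsHermitian :=
    (Ensemble.symmetryOp_isHermitian hM.isPOVM).sub
      (posSemidef_real_smul (S.prob_nonneg j) (S.isState j).posSemidef).isHermitian
  refine Matrix.PosSemidef.of_dotProduct_mulVec_nonneg hherm fun v => ?_
  have hdot : ∀ A : Op d, (Matrix.vecMulVec v (star v) * A).trace = star v ⬝ᵥ Matrix.mulVec A v := by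
    intro A
    rw [Matrix.trace_mul_comm, Matrix.mul_vecMulVec, Matrix.trace_vecMulVec, dotProduct_comm]
  obtain ⟨hs, hs'⟩ := Complex.nonneg_iff.mp (dotProduct_star_self_nonneg v)
  set s : ℝ := (star v ⬝ᵥ v).re with hs_def
  have hsv : star v ⬝ᵥ v = (s : ℂ) := Complex.ext rfl hs'.symm
  -- This scaling bounds the eigenvalue `c * s` of `P` by one and needs no separate case `v = 0`.
  set c : ℝ := (1 + s)⁻¹ with hc_def
  have hc : 0 < c := by positivity
  have hcs : c * s ≤ 1 := by
    rw [hc_def, inv_mul_le_iff₀ (by positivity)]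
    linarith
  set P : Op d := c • Matrix.vecMulVec v (star v) with hP_def
  have hP : P.PosSemidef := posSemidef_real_smul hc.le (Matrix.posSemidef_vecMulVec_self_star v)
  have hPP : P * P = (c * s) • P := by
    rw [hP_def, Matrix.smul_mul, Matrix.mul_smul, Matrix.vecMulVec_mul_vecMulVec, hsv,
      Complex.coe_smul, Matrix.vecMulVec_smul, smul_smul, smul_smul, smul_smul]
    ring_nf
  have hle : 2 * (P * (S.prob j • S.state j - S.symmetryOp M)).trace.re ≤ 0 := by
    refine nonpos_of_forall_add_mul_nonpos (b := ∑ x, S.prob x * (P * M x * P * S.state x).trace.re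
      - S.prob j * (P * P * S.state j).trace.re) fun ε h0 h1 => ?_
    have hpovm : IsPOVM (shiftPOVM M j (ε • P)) := by
      refine isPOVM_shiftPOVM hM.isPOVM j (posSemidef_real_smul h0.le hP).isHermitian ?_
      have : 2 • (ε • P) - (ε • P) * (ε • P) = (ε * (2 - ε * (c * s))) • P := by
        rw [Matrix.smul_mul, Matrix.mul_smul, hPP]
        module
      rw [this]
      have hcs0 : 0 ≤ c * s := by positivity
      exact posSemidef_real_smul (mul_nonneg h0.le (by nlinarith)) hP
    have := hM.success_le _ hpovm
    rw [Ensemble.success_shiftPOVM] at this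
    linarith
  rw [hP_def, Matrix.smul_mul, trace_re_smul, ← neg_sub (S.symmetryOp M), mul_neg,
    Matrix.trace_neg, Complex.neg_re, hdot] at hle
  refine Complex.nonneg_iff.mpr ⟨?_, (hherm.im_star_dotProduct_mulVec_self v).symm⟩
  by_contra! hneg
  nlinarith [mul_pos hc (neg_pos.mpr hneg)]

/-! ### Complementary slackness and the action of channels -/

theorem Ensemble.trace_mul_eq_zero_of_success_eq {K : Op d} {M : Fin n → Op d}
    (hM : IsPOVM M) (hK : ∀ x, (K - S.prob x • S.state x).PosSemidef)
    (h : S.success M = K.trace.re) (x : Fin n) :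
    (M x * (K - S.prob x • S.state x)).trace = 0 := by
  have hnn : ∀ y ∈ Finset.univ, 0 ≤ (M y * (K - S.prob y • S.state y)).trace.re :=
    fun y _ => trace_mul_re_nonneg (hM.posSemidef y) (hK y)
  have hsum : ∑ y, (M y * (K - S.prob y • S.state y)).trace.re = 0 := by
    have := S.success_eq (K := K) hM
    linarith
  exact trace_mul_eq_zero_of_re (hM.posSemidef x) (hK x)
    ((Finset.sum_eq_zero_iff_of_nonneg hnn).mp hsum x (Finset.mem_univ x))

/-- The symmetry operator `K` of complementary states has trace `P_g`, and every optimal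
measurement satisfies complementary slackness with respect to it. -/
theorem Ensemble.IsComplementary.exists_dual {σ : Fin n → Op d} {r : Fin n → ℝ}
    {M : Fin n → Op d} (h : S.IsComplementary σ r) (hM : S.IsOptimal M) :
    ∃ K : Op d, (∀ x, K - S.prob x • S.state x = r x • σ x) ∧
      (∀ x, (r x • σ x).PosSemidef) ∧ S.guessingProb = K.trace.re ∧
      ∀ x, (M x * (r x • σ x)).trace = 0 := by
  obtain ⟨K, M', hM', hK, hort⟩ := h.kkt
  have hsub : ∀ x, K - S.prob x • S.state x = r x • σ x := fun x => by
    rw [hK x, add_sub_cancel_left]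
  have hpos : ∀ x, (r x • σ x).PosSemidef := fun x =>
    posSemidef_real_smul (h.nonneg x) (h.isState x).posSemidef
  have hpos' : ∀ x, (K - S.prob x • S.state x).PosSemidef := fun x => hsub x ▸ hpos x
  have hM'K : S.success M' = K.trace.re := by
    rw [S.success_eq (K := K) hM', Finset.sum_eq_zero, sub_zero]
    intro x _
    have := congrArg Complex.re (hort x)
    rw [hsub, Matrix.mul_smul, trace_re_smul]
    simpa using this
  -- The POVM `M'` of the KKT conditions need not be `M`, but it closes the duality gap, so `M`
  -- attains `tr K` too.
  have hMK : S.success M = K.trace.re :=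
    le_antisymm (S.success_le_trace hM.isPOVM hpos') (hM'K ▸ hM.success_le M' hM')
  refine ⟨K, hsub, hpos, hM.guessingProb_eq.trans hMK, fun x => ?_⟩
  rw [← hsub]
  exact Ensemble.trace_mul_eq_zero_of_success_eq hM.isPOVM hpos' hMK x

theorem Channel.map_posSemidef (N : Channel d) {A : Op d} (hA : A.PosSemidef) :
    (N A).PosSemidef := by
  rw [← Matrix.nonneg_iff_posSemidef] at hA ⊢
  exact map_nonneg N.toCP hA

theorem Channel.map_sub (N : Channel d) (A B : Op d) : N (A - B) = N A - N B :=
  _root_.map_sub N.toCP A B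

theorem Channel.map_real_smul (N : Channel d) (r : ℝ) (A : Op d) : N (r • A) = r • N A := by
  rw [← Complex.coe_smul, ← Complex.coe_smul]
  exact map_smul N.toCP (r : ℂ) A

/-- `N K` is dual feasible for the image ensemble, with the same trace as `K`; this yields `δ ≥ 0`.
-/
theorem Ensemble.success_map_le_trace (N : Channel d) {K : Op d} {M : Fin n → Op d}
    (hM : IsPOVM M) (hK : ∀ x, (K - S.prob x • S.state x).PosSemidef) :
    (S.map N).success M ≤ K.trace.re := by
  rw [← N.trace_map K]
  refine (S.map N).success_le_trace hM fun x => ?_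
  have := N.map_posSemidef (hK x)
  rwa [N.map_sub, N.map_real_smul] at this

/-! ### Necessity on qubits and sufficiency in general -/

/-- On qubits the condition is necessary: the slack operators before and after the channel are
proportional at every identified index. -/
theorem Ensemble.Preserves.ompCondition {S : Ensemble 2 n} {σ : Fin n → Op 2} {r : Fin n → ℝ}
    {M : Fin n → Op 2} {N : Channel 2} (hP : S.Preserves N M) (h : S.IsComplementary σ r) :
    S.OMPCondition N M σ r := by
  obtain ⟨hM, hMN⟩ := hP
  obtain ⟨K, hsub, hpos, hPg, hort⟩ := h.exists_dual hM
  have hδ0 : 0 ≤ S.degradation N := by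
    rw [Ensemble.degradation, hPg, hMN.guessingProb_eq, sub_nonneg]
    exact Ensemble.success_map_le_trace N hMN.isPOVM fun x => hsub x ▸ hpos x
  set K' := (S.map N).symmetryOp M with hK'
  have hpos' := hMN.posSemidef_symmetryOp_sub
  have htr' : (S.map N).success M = K'.trace.re := (Ensemble.trace_symmetryOp M).symm
  have hort' := Ensemble.trace_mul_eq_zero_of_success_eq hMN.isPOVM hpos' htr'
  have hδ : S.degradation N = K.trace.re - K'.trace.re := by
    rw [Ensemble.degradation, hPg, hMN.guessingProb_eq, htr']
  have hstate : ∀ {ρ : Op 2}, IsState ρ → ρ.trace.re = 1 := fun hρ => by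
    rw [hρ.trace_eq_one, Complex.one_re]
  have key : ∀ x, (K' - S.prob x • N (S.state x)).trace.re = r x - S.degradation N := fun x => by
    have h1 := congrArg (fun A : Op 2 => A.trace.re) (hsub x)
    simp only [Matrix.trace_sub, Complex.sub_re, trace_re_smul, hstate (S.isState x),
      hstate (h.isState x)] at h1
    rw [Matrix.trace_sub, Complex.sub_re, trace_re_smul, hstate (N.isState_map (S.isState x)), hδ]
    linarith
  have hr : ∀ x, S.degradation N ≤ r x := fun x => by
    have := (Complex.nonneg_iff.mp (hpos' x).trace_nonneg).1
    have h2 := key x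
    exact sub_nonneg.mp (h2 ▸ this)
  have hmain : ∀ x ∈ identified M,
      K' - S.prob x • N (S.state x) = (r x - S.degradation N) • σ x := fun x hx => by
    set A := K' - S.prob x • N (S.state x) with hA
    have hApos : A.PosSemidef := hpos' x
    have hAtr : A.trace = ((r x - S.degradation N : ℝ) : ℂ) := by
      rw [trace_eq_ofReal_re hApos, key x]
    have hBtr : (r x • σ x).trace = (r x : ℂ) := by
      rw [trace_eq_ofReal_re (hpos x), trace_re_smul, hstate (h.isState x), mul_one]
    have hprop := trace_smul_eq_of_mul_eq_zero hx hApos.isHermitian (hpos x).isHermitian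
      (mul_eq_zero_of_trace_mul_eq_zero (hM.isPOVM.posSemidef x) hApos (hort' x))
      (mul_eq_zero_of_trace_mul_eq_zero (hM.isPOVM.posSemidef x) (hpos x) (hort x))
    rw [hAtr, hBtr, Complex.coe_smul, Complex.coe_smul, smul_comm] at hprop
    -- If `r x = 0`, proportionality is void, but `0 ≤ δ ≤ r x` makes the new slack traceless, hence
    -- zero.
    rcases (h.nonneg x).eq_or_lt with h0 | h0
    · have hz : r x - S.degradation N = 0 := by linarith [hr x]
      rw [hz, zero_smul]
      rw [hz, Complex.ofReal_zero] at hAtr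
      exact hApos.trace_eq_zero_iff.mp hAtr
    · exact smul_right_injective _ h0.ne' hprop
  intro x hx y hy
  refine ⟨?_, hr x, hδ0⟩
  have e1 : S.prob x • N (S.state x) = K' - (r x - S.degradation N) • σ x := by
    rw [← hmain x hx, sub_sub_cancel]
  have e2 : S.prob y • N (S.state y) = K' - (r y - S.degradation N) • σ y := by
    rw [← hmain y hy, sub_sub_cancel]
  have e3 : S.prob x • S.state x = K - r x • σ x := by rw [← hsub x, sub_sub_cancel]
  have e4 : S.prob y • S.state y = K - r y • σ y := by rw [← hsub y, sub_sub_cancel]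
  rw [e1, e2, e3, e4]
  module

theorem Ensemble.OMPCondition.preserves {σ : Fin n → Op d} {r : Fin n → ℝ}
    {M : Fin n → Op d} {N : Channel d} (hC : S.OMPCondition N M σ r)
    (h : S.IsComplementary σ r) (hM : S.IsOptimal M) : S.Preserves N M := by
  obtain ⟨K, hsub, -, hPg, hort⟩ := h.exists_dual hM
  refine ⟨hM, hM.isPOVM, fun M' hM' => (Ensemble.success_le_guessingProb hM').trans_eq ?_⟩
  -- Dimension zero has no states, so the probabilities could not sum to one; `0 < d` then forces
  -- some `M x ≠ 0`.
  have hd : 0 < d := by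
    rcases Nat.eq_zero_or_pos d with rfl | hd
    · have hn : ∀ x : Fin n, False := fun x => by
        have := (S.isState x).trace_eq_one
        simp [Matrix.trace] at this
      have : IsEmpty (Fin n) := ⟨hn⟩
      simpa using S.sum_prob
    · exact hd
  obtain ⟨x₀, hx₀⟩ : ∃ x, x ∈ identified M := by
    by_contra! hne
    have hz : ∀ x, M x = 0 := fun x => not_not.mp (hne x)
    have h1 := hM.isPOVM.sum_eq_one
    simp only [hz, Finset.sum_const_zero] at h1
    have := congrFun (congrFun h1 ⟨0, hd⟩) ⟨0, hd⟩
    simp at this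
  set δ := S.degradation N with hδ
  set K' := S.prob x₀ • N (S.state x₀) + (r x₀ - δ) • σ x₀ with hK'
  have hK'x : ∀ x ∈ identified M, K' - S.prob x • N (S.state x) = (r x - δ) • σ x := by
    intro x hx
    have e := (hC x₀ hx₀ x hx).1
    have e3 : S.prob x₀ • S.state x₀ = K - r x₀ • σ x₀ := by rw [← hsub x₀, sub_sub_cancel]
    have e4 : S.prob x • S.state x = K - r x • σ x := by rw [← hsub x, sub_sub_cancel]
    rw [e3, e4, sub_eq_iff_eq_add] at e
    rw [hK', e]
    module
  have hstate : ∀ {ρ : Op d}, IsState ρ → ρ.trace.re = 1 := fun hρ => by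
    rw [hρ.trace_eq_one, Complex.one_re]
  have htr : K'.trace.re = (S.map N).guessingProb := by
    have h1 := congrArg (fun A : Op d => A.trace.re) (hsub x₀)
    simp only [Matrix.trace_sub, Complex.sub_re, trace_re_smul, hstate (S.isState x₀),
      hstate (h.isState x₀)] at h1
    rw [hK', Matrix.trace_add, Complex.add_re, trace_re_smul, trace_re_smul,
      hstate (N.isState_map (S.isState x₀)), hstate (h.isState x₀), hδ, Ensemble.degradation, hPg]
    linarith
  -- Only the gap identity is needed: `K'` need not be dual feasible at unidentified indices, where
  -- `M x = 0`.
  rw [← htr, (S.map N).success_eq (K := K') hM.isPOVM, Finset.sum_eq_zero, sub_zero]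
  intro x _
  by_cases hx : M x = 0
  · simp [hx]
  · obtain ⟨-, hrx, hδ0⟩ := hC x hx x hx
    change (M x * (K' - S.prob x • N (S.state x))).trace.re = 0
    have h0 := congrArg Complex.re (hort x)
    rw [Matrix.mul_smul, trace_re_smul, Complex.zero_re, mul_eq_zero] at h0
    rw [hK'x x hx, Matrix.mul_smul, trace_re_smul]
    rcases h0 with h0 | h0
    · rw [show r x - δ = 0 by linarith, zero_mul]
    · rw [h0, mul_zero]

end Duality

/-! ### Failure of necessity in dimension at least three -/

section Counterexample

variable {d : ℕ}

/-- Relabelling the basis by a permutation, as a star algebra homomorphism. -/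
def permHom (e : Equiv.Perm (Fin d)) : Op d →⋆ₐ[ℂ] Op d where
  toFun A := A.submatrix e e
  map_one' := Matrix.submatrix_one_equiv e
  map_mul' A B := (Matrix.submatrix_mul_equiv A B e e e).symm
  map_zero' := rfl
  map_add' _ _ := rfl
  commutes' c := by
    simp [Algebra.algebraMap_eq_smul_one, Matrix.submatrix_smul]
  map_star' _ := rfl

/-- The unitary channel permuting the basis vectors. -/
noncomputable def permChannel (e : Equiv.Perm (Fin d)) : Channel d where
  -- Star homomorphisms are completely positive.
  toCP := CompletelyPositiveMapClass.toCompletelyPositiveLinearMap (permHom e)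
  trace_map A := Equiv.sum_comp e fun i => A i i

theorem permChannel_apply (e : Equiv.Perm (Fin d)) (A : Op d) :
    permChannel e A = A.submatrix e e := rfl

/-- The pure state of a basis vector. -/
noncomputable def basisState (i : Fin d) : Op d := Matrix.diagonal (Pi.single i 1)

theorem isState_basisState (i : Fin d) : IsState (basisState i) where
  posSemidef := Matrix.PosSemidef.diagonal (Pi.single_nonneg.mpr zero_le_one)
  trace_eq_one := by simp [basisState, Matrix.trace_diagonal]

theorem permChannel_basisState (e : Equiv.Perm (Fin d)) (i : Fin d) :
    permChannel e (basisState (e i)) = basisState i := by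
  rw [permChannel_apply, basisState, basisState, Matrix.submatrix_diagonal_equiv]
  congr 1
  ext j
  simp [Pi.single_apply]

/-- Two basis states with equal prior probabilities. -/
noncomputable def basisEnsemble (i j : Fin d) : Ensemble d 2 where
  prob _ := 1 / 2
  state := ![basisState i, basisState j]
  prob_nonneg _ := by norm_num
  sum_prob := by norm_num
  isState x := by fin_cases x <;> exact isState_basisState _

/-- The measurement separating a basis vector from its orthogonal complement. -/
noncomputable def basisPOVM (i : Fin d) : Fin 2 → Op d := ![basisState i, 1 - basisState i]

theorem isPOVM_basisPOVM (i : Fin d) : IsPOVM (basisPOVM i) where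
  posSemidef x := by
    fin_cases x
    · exact (isState_basisState i).posSemidef
    · change (1 - basisState i).PosSemidef
      rw [basisState, ← Matrix.diagonal_one, Matrix.diagonal_sub]
      refine Matrix.PosSemidef.diagonal fun k => ?_
      by_cases hk : k = i
      · simp [hk]
      · simp [hk]
  sum_eq_one := by simp [basisPOVM, Fin.sum_univ_two]

theorem trace_basisState_mul (i j : Fin d) :
    (basisState i * basisState j).trace = if i = j then 1 else 0 := by
  rw [basisState, basisState, Matrix.diagonal_mul_diagonal, Matrix.trace_diagonal]
  simp [Pi.single_apply, eq_comm]

theorem success_basisPOVM {S : Ensemble d 2} {i j : Fin d} (hij : i ≠ j)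
    (hp : ∀ x, S.prob x = 1 / 2) (h0 : S.state 0 = basisState i) (h1 : S.state 1 = basisState j) :
    S.success (basisPOVM i) = 1 := by
  rw [Ensemble.success, Fin.sum_univ_two, hp, hp, h0, h1]
  simp only [basisPOVM, Matrix.cons_val_zero, Matrix.cons_val_one, sub_mul, one_mul,
    Matrix.trace_sub, trace_basisState_mul, (isState_basisState j).trace_eq_one, hij, if_true,
    if_false]
  norm_num

theorem isOptimal_basisPOVM {S : Ensemble d 2} {i j : Fin d} (hij : i ≠ j)
    (hp : ∀ x, S.prob x = 1 / 2) (h0 : S.state 0 = basisState i) (h1 : S.state 1 = basisState j) :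
    S.IsOptimal (basisPOVM i) where
  isPOVM := isPOVM_basisPOVM i
  success_le _ hM' := (S.success_le_one hM').trans_eq (success_basisPOVM hij hp h0 h1).symm

/-- The channel moving one of two orthogonal states within the support of its measurement
operator preserves the measurement, but changes the states. -/
theorem exists_preserves_not_ompCondition (hd : 2 < d) :
    ∃ (n : ℕ) (S : Ensemble d n) (σ : Fin n → Op d) (r : Fin n → ℝ)
      (M : Fin n → Op d) (N : Channel d),
      S.IsComplementary σ r ∧ S.IsOptimal M ∧ S.Preserves N M ∧ ¬ S.OMPCondition N M σ r := by
  obtain ⟨i, j, k, hij, hik, hjk⟩ : ∃ i j k : Fin d, i ≠ j ∧ i ≠ k ∧ j ≠ k :=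
    ⟨⟨0, by omega⟩, ⟨1, by omega⟩, ⟨2, hd⟩, by simp, by simp, by simp⟩
  set N := permChannel (Equiv.swap j k) with hN
  have hNi : N (basisState i) = basisState i := by
    have := permChannel_basisState (Equiv.swap j k) i
    rwa [Equiv.swap_apply_of_ne_of_ne hij hik] at this
  have hNj : N (basisState j) = basisState k := by
    have := permChannel_basisState (Equiv.swap j k) k
    rwa [Equiv.swap_apply_right] at this
  have hopt : (basisEnsemble i j).IsOptimal (basisPOVM i) :=
    isOptimal_basisPOVM hij (fun _ => rfl) rfl rfl
  have hoptN : ((basisEnsemble i j).map N).IsOptimal (basisPOVM i) :=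
    isOptimal_basisPOVM hik (fun _ => rfl) hNi hNj
  have hδ : (basisEnsemble i j).degradation N = 0 := by
    rw [Ensemble.degradation, hopt.guessingProb_eq, hoptN.guessingProb_eq,
      success_basisPOVM hij (fun _ => rfl) rfl rfl, success_basisPOVM hik (fun _ => rfl) hNi hNj,
      sub_self]
  -- With `K` the average operator, the slack of each state is half the other state, so the
  -- complementary states are the two states exchanged.
  refine ⟨2, basisEnsemble i j, ![basisState j, basisState i], fun _ => 1 / 2, basisPOVM i, N,
    ⟨fun x => by fin_cases x <;> exact isState_basisState _, fun _ => by norm_num,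
      (1 / 2 : ℝ) • (basisState i + basisState j), basisPOVM i, hopt.isPOVM, fun x => ?_,
      fun x => ?_⟩, hopt, ⟨hopt, hoptN⟩, fun hC => ?_⟩
  · fin_cases x
    · simp [basisEnsemble]
    · simp [basisEnsemble, add_comm]
  · fin_cases x
    · simp [basisPOVM, trace_basisState_mul, hij]
    · simp [basisPOVM, sub_mul, trace_basisState_mul, (isState_basisState i).trace_eq_one]
  · have h0 : (0 : Fin 2) ∈ identified (basisPOVM i) := fun h => by
      have := (isState_basisState i).trace_eq_one
      rw [show basisState i = 0 from h] at this
      simp at this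
    have h1 : (1 : Fin 2) ∈ identified (basisPOVM i) := fun h => by
      have := congrFun (congrFun (show 1 - basisState i = 0 from h) j) j
      simp [basisState, hij.symm] at this
    have h := (hC 0 h0 1 h1).1
    -- As `δ = 0`, the condition would force `basisState j` and `basisState k` to coincide.
    rw [hδ, zero_smul, add_zero] at h
    change (1 / 2 : ℝ) • N (basisState i) - (1 / 2 : ℝ) • N (basisState j) =
      (1 / 2 : ℝ) • basisState i - (1 / 2 : ℝ) • basisState j at h
    rw [hNi, hNj, sub_right_inj] at h
    have := congrFun (congrFun h j) j
    simp [basisState, hjk] at this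

end Counterexample
end QDisc

theorem mainTheorem1 :
    -- qubit ensembles: the condition is necessary and sufficient
    (∀ (n : ℕ) (S : QDisc.Ensemble 2 n) (σ : Fin n → QDisc.Op 2) (r : Fin n → ℝ)
        (M : Fin n → QDisc.Op 2) (N : QDisc.Channel 2),
      S.IsComplementary σ r → S.IsOptimal M →
        (S.Preserves N M ↔ S.OMPCondition N M σ r)) ∧
    -- arbitrary finite dimension: the condition is sufficient
    (∀ (d n : ℕ) (S : QDisc.Ensemble d n) (σ : Fin n → QDisc.Op d) (r : Fin n → ℝ)
        (M : Fin n → QDisc.Op d) (N : QDisc.Channel d),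
      S.IsComplementary σ r → S.IsOptimal M →
        S.OMPCondition N M σ r → S.Preserves N M) ∧
    -- in every dimension greater than two the condition is not necessary
    (∀ d : ℕ, 2 < d →
      ∃ (n : ℕ) (S : QDisc.Ensemble d n) (σ : Fin n → QDisc.Op d) (r : Fin n → ℝ)
        (M : Fin n → QDisc.Op d) (N : QDisc.Channel d),
      S.IsComplementary σ r ∧ S.IsOptimal M ∧
        S.Preserves N M ∧ ¬ S.OMPCondition N M σ r) := by
  refine ⟨fun n S σ r M N h hM => ⟨fun hP => hP.ompCondition h, fun hC => hC.preserves h hM⟩,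
    fun d n S σ r M N h hM hC => hC.preserves h hM,
    fun d hd => QDisc.exists_preserves_not_ompCondition hd⟩
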